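/- Let $H_n$ denote the (physicists') Hermite polynomials, $H_n(y)=(-1)^n e^{y^2}\frac{d^n}{dy^n}e^{-y^2}$, and let $(a)_k=a(a+1)\cdots(a+k-1)$ (with $(a)_0=1$) be the Pochhammer symbol. Let $\ell,m\in\mathbb{N}=\{0,1,2,\dots\}$ with $\ell+m$ even, let $\nu\in\mathbb{C}$ with $\operatorname{Re}\nu>-\frac12$, and let $x\in\mathbb{R}$. Then the function $(s,t)\mapsto|s-xt|^{2\nu}e^{-s^2-t^2}H_\ell(s)H_m(t)$ is Lebesgue integrable on $\mathbb{R}^2$, and $$\int_{-\infty}^{\infty}\int_{-\infty}^{\infty}|s-xt|^{2\nu}e^{-s^2-t^2}H_\ell(s)H_m(t)\,ds\,dt=(-\nu)_{\frac{\ell+m}{2}}\,(-1)^{\frac{\ell-m}{2}}\,2^{\ell+m}\,\pi^{\frac12}\,\Gamma\!\left(\nu+\tfrac12\right)(x^2+1)^{\nu-\frac{\ell+m}{2}}\,x^m,$$ where $x^m=1$ if $x=m=0$. -/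

import Mathlib

open MeasureTheory

/-- The physicists' Hermite polynomials `H₀ = 1`, `Hₙ₊₁ = 2 X Hₙ - Hₙ'`, with leading
coefficient `2 ^ n`. -/
noncomputable def physHermite : ℕ → Polynomial ℝ
  | 0 => 1
  | n + 1 => 2 * Polynomial.X * physHermite n - Polynomial.derivative (physHermite n)

/-- Rodrigues formula `Hₙ(x) = (-1)ⁿ exp(x²) (d/dx)ⁿ exp(-x²)`, which identifies
`physHermite n` with the classical Hermite polynomial orthogonal for `exp(-x²) dx`. -/
theorem physHermite_eval_eq (n : ℕ) (x : ℝ) :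
    (physHermite n).eval x =
      (-1) ^ n * Real.exp (x ^ 2) * iteratedDeriv n (fun y : ℝ => Real.exp (-y ^ 2)) x := by
  have key : ∀ n : ℕ, iteratedDeriv n (fun y : ℝ => Real.exp (-y ^ 2)) =
      fun y => (-1) ^ n * (physHermite n).eval y * Real.exp (-y ^ 2) := by
    intro n
    induction n with
    | zero => funext y; simp [physHermite]
    | succ n ih =>
      funext y
      rw [iteratedDeriv_succ, ih]
      have h1 : HasDerivAt (fun y : ℝ => Real.exp (-y ^ 2))
          (Real.exp (-y ^ 2) * (-(2 * y))) y := by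
        have h0 : HasDerivAt (fun y : ℝ => -y ^ 2) (-(2 * y)) y := by
          exact ((hasDerivAt_pow 2 y).fun_neg).congr_deriv (by norm_num)
        exact h0.exp
      have h2 := (((physHermite n).hasDerivAt y).const_mul ((-1 : ℝ) ^ n)).mul h1
      refine h2.deriv.trans ?_
      simp only [physHermite, Polynomial.eval_sub, Polynomial.eval_mul, Polynomial.eval_X,
        Polynomial.eval_ofNat, pow_succ]
      ring
  have h4 : ((-1 : ℝ) ^ n) * (-1) ^ n = 1 := by rw [← mul_pow]; simp
  have h5 : Real.exp (x ^ 2) * Real.exp (-x ^ 2) = 1 := by rw [← Real.exp_add]; simp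
  rw [key n]
  calc (physHermite n).eval x
      = (((-1 : ℝ) ^ n) * (-1) ^ n) * (Real.exp (x ^ 2) * Real.exp (-x ^ 2)) *
          (physHermite n).eval x := by rw [h4, h5]; ring
    _ = _ := by ring

/-- The function `(s, t) ↦ |s - x t| ^ (2 ν) exp(-s² - t²) H_ℓ(s) H_m(t)`. -/
noncomputable def hermiteIntegrand (ℓ m : ℕ) (ν : ℂ) (x s t : ℝ) : ℂ :=
  ((|s - x * t| : ℝ) : ℂ) ^ (2 * ν) * ((Real.exp (-s ^ 2 - t ^ 2) : ℝ) : ℂ) *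
    (((physHermite ℓ).eval s : ℝ) : ℂ) * (((physHermite m).eval t : ℝ) : ℂ)

/-! With `r = √(1 + x²)`, `c = 1/r`, `d = x/r`, the rotation `s = c u + d v`, `t = -d u + c v` turns
`s - x t` into `r u` and preserves `s² + t²`. The weight then no longer depends on `v` except
through `exp (-v²)`, and the integral splits into two one-variable problems. Integrating out `v`
collapses the product of Hermite polynomials to `√π c^ℓ (-d)^m H_{ℓ+m}(u)`
(`gaussianFunctional_rotatedHermite`), since both sides obey the same recurrences in `ℓ` and `m`.
With `ℓ + m = 2k`, what remains is the integral of `|u|^(2ν) exp (-u²) H_{2k}(u)`, equal to `(-4)^k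
(-ν)_k Γ(ν + 1/2)` (`absPowGaussianFunctional_physHermite`): integration by parts gives a factor
`4(ν - k)` for each passage from `2k` to `2k + 2`. -/

/-! ### Recurrences for Hermite polynomials -/

open Polynomial in
theorem derivative_physHermite (n : ℕ) :
    derivative (physHermite n) = C (2 * (n : ℝ)) * physHermite (n - 1) := by
  induction n with
  | zero => simp [physHermite]
  | succ n ih =>
    have h2 : (2 : ℝ[X]) = C 2 := rfl
    cases n with
    | zero => simp [physHermite, h2]
    | succ n =>
      simp only [Nat.add_sub_cancel] at ih ⊢
      rw [physHermite, derivative_sub, derivative_mul, derivative_mul, ih, derivative_C_mul]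
      simp only [physHermite, derivative_X, h2, derivative_C, map_mul, map_add, map_natCast,
        Nat.cast_add, Nat.cast_one, map_one]
      ring

open Polynomial in
theorem physHermite_succ (n : ℕ) :
    physHermite (n + 1) = 2 * X * physHermite n - C (2 * (n : ℝ)) * physHermite (n - 1) := by
  rw [physHermite, derivative_physHermite]

theorem eval_physHermite_succ (n : ℕ) (y : ℝ) :
    (physHermite (n + 1)).eval y =
      2 * y * (physHermite n).eval y - 2 * n * (physHermite (n - 1)).eval y := by
  rw [physHermite_succ]
  simp

/-! ### Polynomials against the Gaussian weight -/

/-- Half of the Gaussian decay is given up to absorb any polynomial; every domination argument below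
rests on this. -/
theorem exists_abs_eval_le_mul_exp (p : Polynomial ℝ) :
    ∃ C : ℝ, ∀ y : ℝ, |p.eval y| ≤ C * Real.exp (y ^ 2 / 2) := by
  induction p using Polynomial.induction_on' with
  | add p q hp hq =>
    obtain ⟨C, hC⟩ := hp
    obtain ⟨D, hD⟩ := hq
    refine ⟨C + D, fun y => ?_⟩
    rw [Polynomial.eval_add, add_mul]
    exact (abs_add_le _ _).trans (add_le_add (hC y) (hD y))
  | monomial n a =>
    refine ⟨|a| * (1 + 2 ^ n * n.factorial), fun y => ?_⟩
    have h1 := Real.pow_div_factorial_le_exp (y ^ 2 / 2) (by positivity) n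
    rw [div_le_iff₀ (by positivity), div_pow, div_le_iff₀ (by positivity)] at h1
    have h2 : 1 ≤ Real.exp (y ^ 2 / 2) := Real.one_le_exp (by positivity)
    have h3 : |y| ^ n ≤ 1 + (y ^ 2) ^ n := by
      have : (y ^ 2) ^ n = (|y| ^ n) ^ 2 := by rw [← sq_abs, ← pow_mul, ← pow_mul, mul_comm]
      rw [this]
      nlinarith [sq_nonneg (|y| ^ n - 1), sq_nonneg (|y| ^ n)]
    rw [Polynomial.eval_monomial, abs_mul, abs_pow, mul_assoc]
    refine mul_le_mul_of_nonneg_left ?_ (abs_nonneg a)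
    nlinarith

theorem integrable_eval_mul_exp_neg_sq (p : Polynomial ℝ) :
    Integrable fun v : ℝ => p.eval v * Real.exp (-v ^ 2) := by
  obtain ⟨C, hC⟩ := exists_abs_eval_le_mul_exp p
  refine ((integrable_exp_neg_mul_sq (by norm_num : (0 : ℝ) < 1 / 2)).const_mul C).mono'
    (by fun_prop) (.of_forall fun v => ?_)
  rw [norm_mul, Real.norm_eq_abs, Real.norm_of_nonneg (Real.exp_pos _).le]
  calc _ ≤ C * Real.exp (v ^ 2 / 2) * Real.exp (-v ^ 2) := by gcongr; exact hC v
    _ = _ := by rw [mul_assoc, ← Real.exp_add]; ring_nf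

/-- The integral of a polynomial against the Gaussian weight `exp (-v ^ 2)`. -/
noncomputable def gaussianFunctional : Polynomial ℝ →ₗ[ℝ] ℝ where
  toFun p := ∫ v : ℝ, p.eval v * Real.exp (-v ^ 2)
  map_add' p q := by
    simp only [Polynomial.eval_add, add_mul]
    exact integral_add (integrable_eval_mul_exp_neg_sq p) (integrable_eval_mul_exp_neg_sq q)
  map_smul' a p := by
    simp only [Polynomial.eval_smul, smul_eq_mul, mul_assoc, RingHom.id_apply]
    exact integral_const_mul _ _

theorem gaussianFunctional_apply (p : Polynomial ℝ) :
    gaussianFunctional p = ∫ v : ℝ, p.eval v * Real.exp (-v ^ 2) := rfl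

theorem gaussianFunctional_one : gaussianFunctional 1 = √Real.pi := by
  simpa [gaussianFunctional_apply] using integral_gaussian 1

-- Integration by parts: the derivative of `p(v) exp (-v²)` has integral zero.
open Polynomial in
theorem gaussianFunctional_two_X_mul (p : ℝ[X]) :
    gaussianFunctional (2 * X * p) = gaussianFunctional (derivative p) := by
  have h (v : ℝ) : HasDerivAt (fun v => p.eval v * Real.exp (-v ^ 2))
      ((derivative p - 2 * X * p).eval v * Real.exp (-v ^ 2)) v := by
    have h0 : HasDerivAt (fun y : ℝ => -y ^ 2) (-(2 * v)) v :=
      ((hasDerivAt_pow 2 v).fun_neg).congr_deriv (by norm_num)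
    refine ((p.hasDerivAt v).mul h0.exp).congr_deriv ?_
    simp
    ring
  have := integral_eq_zero_of_hasDerivAt_of_integrable h
    (integrable_eval_mul_exp_neg_sq _) (integrable_eval_mul_exp_neg_sq p)
  rw [← gaussianFunctional_apply, map_sub, sub_eq_zero] at this
  exact this.symm

/-! ### Gaussian average of a rotated Hermite product -/

open Polynomial in
/-- `physHermite ℓ` in the variable `c u + d v` times `physHermite m` in the variable
`-d u + c v`, as a polynomial in `v`. -/
noncomputable def rotatedHermite (c d u : ℝ) (ℓ m : ℕ) : ℝ[X] :=
  (physHermite ℓ).comp (C (c * u) + C d * X) * (physHermite m).comp (C (-(d * u)) + C c * X)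

theorem eval_rotatedHermite (c d u v : ℝ) (ℓ m : ℕ) :
    (rotatedHermite c d u ℓ m).eval v =
      (physHermite ℓ).eval (c * u + d * v) * (physHermite m).eval (-(d * u) + c * v) := by
  simp [rotatedHermite]

open Polynomial in
theorem derivative_rotatedHermite (c d u : ℝ) (ℓ m : ℕ) :
    derivative (rotatedHermite c d u ℓ m) =
      C (2 * ℓ * d) * rotatedHermite c d u (ℓ - 1) m +
        C (2 * m * c) * rotatedHermite c d u ℓ (m - 1) := by
  simp only [rotatedHermite, derivative_mul, derivative_comp, derivative_physHermite]
  simp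
  ring

theorem gaussianFunctional_C_mul (a : ℝ) (p : Polynomial ℝ) :
    gaussianFunctional (Polynomial.C a * p) = a * gaussianFunctional p := by
  rw [Polynomial.C_mul', map_smul, smul_eq_mul]

-- The Hermite recurrence produces a factor `2(c u + d v)`, whose `v` part is integrated by parts;
-- `c² + d² = 1` merges the two `ℓ - 1` terms. At `ℓ = 0` or `m = 0` the truncated index is
-- harmless, its coefficient being zero.
open Polynomial in
theorem gaussianFunctional_rotatedHermite_succ_left (c d u : ℝ) (h : c ^ 2 + d ^ 2 = 1)
    (ℓ m : ℕ) :
    gaussianFunctional (rotatedHermite c d u (ℓ + 1) m) =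
      2 * c * u * gaussianFunctional (rotatedHermite c d u ℓ m)
        - 2 * ℓ * c ^ 2 * gaussianFunctional (rotatedHermite c d u (ℓ - 1) m)
        + 2 * m * c * d * gaussianFunctional (rotatedHermite c d u ℓ (m - 1)) := by
  have e : rotatedHermite c d u (ℓ + 1) m = C (2 * c * u) * rotatedHermite c d u ℓ m
      + C d * (2 * X * rotatedHermite c d u ℓ m)
      - C (2 * (ℓ : ℝ)) * rotatedHermite c d u (ℓ - 1) m := by
    have h2 : (2 : ℝ[X]) = C 2 := rfl
    rw [rotatedHermite, physHermite_succ]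
    simp only [rotatedHermite, sub_comp, mul_comp, X_comp, C_comp, map_mul, h2]
    ring
  rw [e, map_sub, map_add]
  simp only [gaussianFunctional_C_mul, gaussianFunctional_two_X_mul, derivative_rotatedHermite,
    map_add]
  linear_combination (-2 * ℓ * gaussianFunctional (rotatedHermite c d u (ℓ - 1) m)) * -h

open Polynomial in
theorem gaussianFunctional_rotatedHermite_succ_right (c d u : ℝ) (h : c ^ 2 + d ^ 2 = 1)
    (ℓ m : ℕ) :
    gaussianFunctional (rotatedHermite c d u ℓ (m + 1)) =
      -(2 * d * u) * gaussianFunctional (rotatedHermite c d u ℓ m)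
        - 2 * m * d ^ 2 * gaussianFunctional (rotatedHermite c d u ℓ (m - 1))
        + 2 * ℓ * c * d * gaussianFunctional (rotatedHermite c d u (ℓ - 1) m) := by
  have e : rotatedHermite c d u ℓ (m + 1) = C (-(2 * d * u)) * rotatedHermite c d u ℓ m
      + C c * (2 * X * rotatedHermite c d u ℓ m)
      - C (2 * (m : ℝ)) * rotatedHermite c d u ℓ (m - 1) := by
    have h2 : (2 : ℝ[X]) = C 2 := rfl
    rw [rotatedHermite, physHermite_succ]
    simp only [rotatedHermite, sub_comp, mul_comp, X_comp, C_comp, map_mul, map_neg, h2]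
    ring
  rw [e, map_sub, map_add]
  simp only [gaussianFunctional_C_mul, gaussianFunctional_two_X_mul, derivative_rotatedHermite,
    map_add]
  linear_combination (-2 * m * gaussianFunctional (rotatedHermite c d u ℓ (m - 1))) * -h

/-- In the recurrence in `ℓ`, the terms with `ℓ - 1` and `m - 1` both carry `H_{ℓ+m-1}(u)`, and
their coefficients add up to the `-2(ℓ + m)` of the recurrence for `H_{ℓ+m+1}`. -/
theorem gaussianFunctional_rotatedHermite (c d u : ℝ) (h : c ^ 2 + d ^ 2 = 1) (ℓ m : ℕ) :
    gaussianFunctional (rotatedHermite c d u ℓ m) =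
      √Real.pi * c ^ ℓ * (-d) ^ m * (physHermite (ℓ + m)).eval u := by
  induction ℓ using Nat.strong_induction_on generalizing m with
  | _ ℓ ihℓ =>
  rcases ℓ with _ | ℓ
  · induction m using Nat.strong_induction_on with
    | _ m ihm =>
    rcases m with _ | m
    · simp [rotatedHermite, physHermite, gaussianFunctional_one]
    rw [gaussianFunctional_rotatedHermite_succ_right c d u h, ihm m (by omega),
      ihm (m - 1) (by omega), ← add_assoc, eval_physHermite_succ]
    rcases m with _ | m
    · simp
      ring
    · simp only [Nat.add_sub_cancel, ← add_assoc]
      push_cast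
      simp only [zero_add]
      ring
  · rw [gaussianFunctional_rotatedHermite_succ_left c d u h, ihℓ ℓ (by omega),
      ihℓ (ℓ - 1) (by omega), ihℓ ℓ (by omega), add_right_comm, eval_physHermite_succ]
    rcases ℓ with _ | ℓ <;> rcases m with _ | m
    · simp
      ring
    · simp
      ring
    · simp
      ring
    · have e1 : ℓ + 1 + (m + 1) - 1 = ℓ + m + 1 := by omega
      have e2 : ℓ + (m + 1) = ℓ + m + 1 := by omega
      have e3 : ℓ + 1 + m = ℓ + m + 1 := by omega
      simp only [Nat.add_sub_cancel, e1, e2, e3]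
      push_cast
      ring

/-! ### The weight `|u|^(2ν) exp (-u²)` on the line -/

theorem integrable_abs_rpow_mul_exp_neg_mul_sq {b : ℝ} (hb : 0 < b) {a : ℝ} (ha : -1 < a) :
    Integrable fun u : ℝ => |u| ^ a * Real.exp (-b * u ^ 2) := by
  have h := (integrableOn_rpow_mul_exp_neg_mul_sq hb ha).integrable_indicator measurableSet_Ioi
  refine (h.add h.comp_neg).congr ?_
  filter_upwards [compl_mem_ae_iff.2 (measure_singleton (0 : ℝ))] with u hu
  rcases lt_or_gt_of_ne (show u ≠ 0 from hu) with h0 | h0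
  · simp [Set.indicator, h0, h0.not_gt, abs_of_neg h0]
  · simp [Set.indicator, h0, h0.not_gt, abs_of_pos h0]

theorem norm_ofReal_abs_cpow (ν : ℂ) (u : ℝ) (hu : u ≠ 0) :
    ‖((|u| : ℝ) : ℂ) ^ (2 * ν)‖ = |u| ^ (2 * ν.re) := by
  rw [Complex.norm_cpow_eq_rpow_re_of_pos (abs_pos.2 hu)]
  simp

theorem integrable_abs_cpow_mul_exp_mul_eval {ν : ℂ} (hν : -(1 / 2 : ℝ) < ν.re)
    (p : Polynomial ℝ) :
    Integrable fun u : ℝ => ((|u| : ℝ) : ℂ) ^ (2 * ν) *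
      ((p.eval u * Real.exp (-u ^ 2) : ℝ) : ℂ) := by
  obtain ⟨C, hC⟩ := exists_abs_eval_le_mul_exp p
  refine ((integrable_abs_rpow_mul_exp_neg_mul_sq (by norm_num : (0 : ℝ) < 1 / 2)
    (by linarith : -1 < 2 * ν.re)).const_mul C).mono'
    (Measurable.aestronglyMeasurable (by fun_prop)) ?_
  filter_upwards [compl_mem_ae_iff.2 (measure_singleton (0 : ℝ))] with u hu
  rw [norm_mul, norm_ofReal_abs_cpow ν u hu, Complex.norm_real, norm_mul, Real.norm_eq_abs,
    Real.norm_of_nonneg (Real.exp_pos _).le]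
  calc _ ≤ |u| ^ (2 * ν.re) * (C * Real.exp (u ^ 2 / 2) * Real.exp (-u ^ 2)) := by
        gcongr
        exact hC u
    _ = _ := by rw [mul_assoc C, ← Real.exp_add]; ring_nf

/-- The integral of a polynomial against the weight `|u| ^ (2 ν) exp (-u ^ 2)`. -/
noncomputable def absPowGaussianFunctional (ν : ℂ) (p : Polynomial ℝ) : ℂ :=
  ∫ u : ℝ, ((|u| : ℝ) : ℂ) ^ (2 * ν) * ((p.eval u * Real.exp (-u ^ 2) : ℝ) : ℂ)

theorem absPowGaussianFunctional_add {ν : ℂ} (hν : -(1 / 2 : ℝ) < ν.re) (p q : Polynomial ℝ) :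
    absPowGaussianFunctional ν (p + q) =
      absPowGaussianFunctional ν p + absPowGaussianFunctional ν q := by
  rw [absPowGaussianFunctional, absPowGaussianFunctional, absPowGaussianFunctional,
    ← integral_add (integrable_abs_cpow_mul_exp_mul_eval hν p)
      (integrable_abs_cpow_mul_exp_mul_eval hν q)]
  simp only [Polynomial.eval_add, add_mul, Complex.ofReal_add, mul_add]

theorem absPowGaussianFunctional_C_mul (ν : ℂ) (a : ℝ) (p : Polynomial ℝ) :
    absPowGaussianFunctional ν (Polynomial.C a * p) = a * absPowGaussianFunctional ν p := by
  rw [absPowGaussianFunctional, absPowGaussianFunctional, ← integral_const_mul]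
  congr 1 with u
  simp
  ring

theorem absPowGaussianFunctional_X_pow_odd (ν : ℂ) {j : ℕ} (hj : Odd j) :
    absPowGaussianFunctional ν (Polynomial.X ^ j) = 0 := by
  have h := integral_neg_eq_self (fun u : ℝ => ((|u| : ℝ) : ℂ) ^ (2 * ν) *
      (((Polynomial.X ^ j : Polynomial ℝ).eval u * Real.exp (-u ^ 2) : ℝ) : ℂ)) volume
  simp only [abs_neg, Polynomial.eval_pow, Polynomial.eval_X, hj.neg_pow, neg_sq, neg_mul,
    Complex.ofReal_neg, mul_neg] at h
  rw [integral_neg] at h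
  simp only [absPowGaussianFunctional, Polynomial.eval_pow, Polynomial.eval_X]
  exact CharZero.neg_eq_self_iff.1 h

/-- Substitution `t = u²` in Euler's integral, seen as a Mellin transform. -/
theorem integral_Ioi_cpow_mul_exp_neg_sq {s : ℂ} (hs : 0 < s.re) :
    ∫ u : ℝ in Set.Ioi 0, (u : ℂ) ^ (2 * s - 1) * (Real.exp (-u ^ 2) : ℂ) =
      Complex.Gamma s / 2 := by
  have h := mellin_comp_rpow (fun t : ℝ => ((Real.exp (-t) : ℝ) : ℂ)) (2 * s) 2
  rw [Complex.Gamma_eq_integral hs, Complex.GammaIntegral_eq_mellin]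
  have e : 2 * s / ((2 : ℝ) : ℂ) = s := by push_cast; field_simp
  rw [e] at h
  simp only [mellin, smul_eq_mul, Real.rpow_two] at h ⊢
  rw [h]
  simp
  ring

theorem integral_eq_two_mul_integral_Ioi_of_even {f : ℝ → ℂ} (hf : Integrable f)
    (heven : ∀ u, f (-u) = f u) : ∫ u, f u = 2 * ∫ u in Set.Ioi 0, f u := by
  rw [← intervalIntegral.integral_Iic_add_Ioi hf.integrableOn hf.integrableOn (b := 0)]
  have := integral_comp_neg_Ioi 0 f
  simp only [heven, neg_zero] at this
  rw [← this, two_mul]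

theorem absPowGaussianFunctional_X_pow_even {ν : ℂ} (hν : -(1 / 2 : ℝ) < ν.re) (j : ℕ) :
    absPowGaussianFunctional ν (Polynomial.X ^ (2 * j)) = Complex.Gamma (ν + 1 / 2 + j) := by
  rw [absPowGaussianFunctional, integral_eq_two_mul_integral_Ioi_of_even
    (integrable_abs_cpow_mul_exp_mul_eval hν _) (by simp [Even.neg_pow])]
  have hs : 0 < (ν + 1 / 2 + j).re := by
    simp
    have : (0 : ℝ) ≤ j := j.cast_nonneg
    linarith
  have h := integral_Ioi_cpow_mul_exp_neg_sq hs
  rw [show Complex.Gamma (ν + 1 / 2 + j) = 2 * (Complex.Gamma (ν + 1 / 2 + j) / 2) by ring, ← h]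
  congr 1
  refine setIntegral_congr_fun measurableSet_Ioi fun u hu => ?_
  have hu' : (0 : ℝ) < u := hu
  have hne : (u : ℂ) ≠ 0 := by exact_mod_cast hu'.ne'
  simp only [Polynomial.eval_pow, Polynomial.eval_X, abs_of_pos hu', Complex.ofReal_mul,
    Complex.ofReal_pow]
  rw [show 2 * (ν + 1 / 2 + j) - 1 = 2 * ν + ((2 * j : ℕ) : ℂ) by push_cast; ring,
    Complex.cpow_add _ _ hne, Complex.cpow_natCast]
  ring

-- Formally an integration by parts, where the factor `X` cancels the `1/u` from differentiating
-- `|u|^(2ν)`. Checking it on monomials avoids the singularity at `0`: even degrees reduce to `Γ(s +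
-- 1) = s Γ(s)`, odd ones vanish.
open Polynomial in
theorem absPowGaussianFunctional_two_X_mul_X_mul {ν : ℂ} (hν : -(1 / 2 : ℝ) < ν.re) (p : ℝ[X]) :
    absPowGaussianFunctional ν (2 * X * (X * p)) =
      2 * ν * absPowGaussianFunctional ν p + absPowGaussianFunctional ν (derivative (X * p)) := by
  induction p using Polynomial.induction_on' with
  | add p q hp hq =>
    simp only [mul_add, map_add, absPowGaussianFunctional_add hν] at hp hq ⊢
    rw [hp, hq]
    ring
  | monomial n a =>
    have e1 : 2 * X * (X * monomial n a) = C (2 * a) * X ^ (n + 2) := by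
      rw [← C_mul_X_pow_eq_monomial, map_mul, show (C 2 : ℝ[X]) = 2 from rfl]
      ring
    have e2 : derivative (X * monomial n a) = C ((n + 1) * a) * X ^ n := by
      rw [X_mul_monomial, derivative_monomial, ← C_mul_X_pow_eq_monomial]
      simp [mul_comm]
    rw [e1, e2, ← C_mul_X_pow_eq_monomial]
    simp only [absPowGaussianFunctional_C_mul]
    rcases Nat.even_or_odd' n with ⟨j, rfl | rfl⟩
    · rw [show 2 * j + 2 = 2 * (j + 1) by ring, absPowGaussianFunctional_X_pow_even hν,
        absPowGaussianFunctional_X_pow_even hν]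
      have hne : ν + 1 / 2 + j ≠ 0 := by
        intro h
        have := congrArg Complex.re h
        simp at this
        have : (0 : ℝ) ≤ j := j.cast_nonneg
        linarith
      rw [Nat.cast_add, Nat.cast_one, ← add_assoc, Complex.Gamma_add_one _ hne]
      push_cast
      ring
    · rw [absPowGaussianFunctional_X_pow_odd ν ⟨j, rfl⟩,
        absPowGaussianFunctional_X_pow_odd ν ⟨j + 1, by ring⟩]
      simp

-- Writing `H_{2k+1} = X p_k`, integration by parts gives `L(H_{2k+2}) = 2ν L(p_k)`, and the Hermite
-- recurrence gives `p_{k+1} = 2 H_{2k+2} - 4(k + 1) p_k`. Multiplying by `2ν` yields the factor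
-- `4(ν - k - 1)`. The quotient `p_k` is carried through the induction so that `ν` is never divided
-- by.
open Polynomial in
theorem absPowGaussianFunctional_physHermite_aux {ν : ℂ} (hν : -(1 / 2 : ℝ) < ν.re) (k : ℕ) :
    (∃ p : ℝ[X], physHermite (2 * k + 1) = X * p ∧
      absPowGaussianFunctional ν (physHermite (2 * (k + 1))) =
        2 * ν * absPowGaussianFunctional ν p) ∧
      absPowGaussianFunctional ν (physHermite (2 * (k + 1))) =
        4 * (ν - k) * absPowGaussianFunctional ν (physHermite (2 * k)) := by
  have key (k : ℕ) (p : ℝ[X]) (h : physHermite (2 * k + 1) = X * p) :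
      absPowGaussianFunctional ν (physHermite (2 * (k + 1))) =
        2 * ν * absPowGaussianFunctional ν p := by
    have e : physHermite (2 * (k + 1)) + derivative (X * p) = 2 * X * (X * p) := by
      rw [show 2 * (k + 1) = 2 * k + 1 + 1 by ring, physHermite, h]
      ring
    have := absPowGaussianFunctional_two_X_mul_X_mul hν p
    rw [← e, absPowGaussianFunctional_add hν] at this
    exact add_right_cancel this
  induction k with
  | zero =>
    have h : physHermite (2 * 0 + 1) = X * C 2 := by
      simp [physHermite, mul_comm, show (C 2 : ℝ[X]) = 2 from rfl]
    refine ⟨⟨C 2, h, key 0 _ h⟩, ?_⟩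
    rw [key 0 _ h, ← mul_one (C 2), absPowGaussianFunctional_C_mul]
    simp [physHermite]
    ring
  | succ k ih =>
    obtain ⟨⟨p, hp, hp'⟩, -⟩ := ih
    have h : physHermite (2 * (k + 1) + 1) =
        X * (C 2 * physHermite (2 * (k + 1)) + C (-(2 * ((2 * (k + 1) : ℕ) : ℝ))) * p) := by
      rw [physHermite_succ, show 2 * (k + 1) - 1 = 2 * k + 1 by omega, hp, C_neg,
        show (C 2 : ℝ[X]) = 2 from rfl]
      ring
    refine ⟨⟨_, h, key _ _ h⟩, ?_⟩
    rw [key _ _ h, absPowGaussianFunctional_add hν, absPowGaussianFunctional_C_mul,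
      absPowGaussianFunctional_C_mul]
    push_cast
    linear_combination (4 * ((k : ℂ) + 1)) * hp'

theorem absPowGaussianFunctional_physHermite {ν : ℂ} (hν : -(1 / 2 : ℝ) < ν.re) (k : ℕ) :
    absPowGaussianFunctional ν (physHermite (2 * k)) =
      (-4) ^ k * (ascPochhammer ℂ k).eval (-ν) * Complex.Gamma (ν + 1 / 2) := by
  induction k with
  | zero =>
    simpa [physHermite] using absPowGaussianFunctional_X_pow_even hν 0
  | succ k ih =>
    rw [(absPowGaussianFunctional_physHermite_aux hν k).2, ih, ascPochhammer_succ_eval]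
    ring

/-! ### Rotation of the plane and the double integral -/

/-- Rotation of the plane by the orthogonal matrix `!![c, d; -d, c]` preserves volume. -/
theorem exists_rotation_measurableEquiv (c d : ℝ) (h : c ^ 2 + d ^ 2 = 1) :
    ∃ e : ℝ × ℝ ≃ᵐ ℝ × ℝ, MeasurePreserving e ∧
      ∀ u v, e (u, v) = (c * u + d * v, -(d * u) + c * v) := by
  -- The rotation is multiplication by the unit complex number `c - d i`.
  have hz : (⟨c, -d⟩ : ℂ) ∈ Submonoid.unitSphere ℂ := by
    change _ ∈ Metric.sphere (0 : ℂ) 1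
    rw [mem_sphere_zero_iff_norm, ← sq_eq_sq₀ (norm_nonneg _) zero_le_one, Complex.sq_norm,
      Complex.normSq_mk]
    linarith
  let r := rotation ⟨_, hz⟩
  refine ⟨Complex.measurableEquivRealProd.symm.trans
    (r.toMeasurableEquiv.trans Complex.measurableEquivRealProd), ?_, fun u v => ?_⟩
  · exact (Complex.volume_preserving_equiv_real_prod.comp r.measurePreserving).comp
      (Complex.volume_preserving_equiv_real_prod.symm _)
  · have hr : r ⟨u, v⟩ = ⟨c, -d⟩ * ⟨u, v⟩ := rfl
    simp only [MeasurableEquiv.trans_apply, LinearIsometryEquiv.coe_toMeasurableEquiv,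
      Complex.measurableEquivRealProd_apply, Complex.measurableEquivRealProd_symm_apply]
    rw [hr]
    ext
    · simp
    · simp
      ring

theorem hermiteIntegrand_rotate (ℓ m : ℕ) (ν : ℂ) {x r : ℝ} (hr : 0 < r) (hrx : r ^ 2 = 1 + x ^ 2)
    (u v : ℝ) :
    hermiteIntegrand ℓ m ν x (r⁻¹ * u + x * r⁻¹ * v) (-(x * r⁻¹ * u) + r⁻¹ * v) =
      (r : ℂ) ^ (2 * ν) * (((|u| : ℝ) : ℂ) ^ (2 * ν) * (Real.exp (-u ^ 2) : ℂ)) *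
        (((rotatedHermite r⁻¹ (x * r⁻¹) u ℓ m).eval v * Real.exp (-v ^ 2) : ℝ) : ℂ) := by
  have h1 : r⁻¹ * u + x * r⁻¹ * v - x * (-(x * r⁻¹ * u) + r⁻¹ * v) = r * u := by
    field_simp
    linear_combination -u * hrx
  have h2 : -(r⁻¹ * u + x * r⁻¹ * v) ^ 2 - (-(x * r⁻¹ * u) + r⁻¹ * v) ^ 2 = -u ^ 2 + -v ^ 2 := by
    field_simp
    linear_combination (u ^ 2 + v ^ 2) * hrx
  rw [hermiteIntegrand, h1, h2, Real.exp_add, abs_mul, abs_of_pos hr, Complex.ofReal_mul,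
    Complex.mul_cpow_ofReal_nonneg hr.le (abs_nonneg u), eval_rotatedHermite]
  push_cast
  ring

theorem inv_sq_add_mul_inv_sq_eq_one {x r : ℝ} (hr : 0 < r) (hrx : r ^ 2 = 1 + x ^ 2) :
    r⁻¹ ^ 2 + (x * r⁻¹) ^ 2 = 1 := by
  field_simp
  linarith

theorem measurable_hermiteIntegrand (ℓ m : ℕ) (ν : ℂ) (x : ℝ) :
    Measurable fun p : ℝ × ℝ => hermiteIntegrand ℓ m ν x p.1 p.2 := by
  have (n : ℕ) : Measurable fun y : ℝ => (physHermite n).eval y := (physHermite n).continuous.measurable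
  unfold hermiteIntegrand
  fun_prop

theorem norm_hermiteIntegrand_le (ℓ m : ℕ) (ν : ℂ) (x : ℝ) :
    ∃ C : ℝ, ∀ s t, ‖hermiteIntegrand ℓ m ν x s t‖ ≤
      C * (‖((|s - x * t| : ℝ) : ℂ) ^ (2 * ν)‖ * Real.exp (-(1 / 2) * (s ^ 2 + t ^ 2))) := by
  obtain ⟨C, hC⟩ := exists_abs_eval_le_mul_exp (physHermite ℓ)
  obtain ⟨D, hD⟩ := exists_abs_eval_le_mul_exp (physHermite m)
  refine ⟨C * D, fun s t => ?_⟩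
  have hexp : Real.exp (-s ^ 2 - t ^ 2) * Real.exp (s ^ 2 / 2) * Real.exp (t ^ 2 / 2) =
      Real.exp (-(1 / 2) * (s ^ 2 + t ^ 2)) := by
    rw [← Real.exp_add, ← Real.exp_add]
    ring_nf
  have hmul : |(physHermite ℓ).eval s| * |(physHermite m).eval t| ≤
      (C * Real.exp (s ^ 2 / 2)) * (D * Real.exp (t ^ 2 / 2)) :=
    mul_le_mul (hC s) (hD t) (abs_nonneg _) ((abs_nonneg _).trans (hC s))
  rw [hermiteIntegrand, norm_mul, norm_mul, norm_mul, Complex.norm_real, Complex.norm_real,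
    Complex.norm_real, Real.norm_of_nonneg (Real.exp_pos _).le, Real.norm_eq_abs,
    Real.norm_eq_abs, mul_assoc _ |_| |_|, ← hexp]
  calc _ ≤ ‖((|s - x * t| : ℝ) : ℂ) ^ (2 * ν)‖ * Real.exp (-s ^ 2 - t ^ 2) *
        ((C * Real.exp (s ^ 2 / 2)) * (D * Real.exp (t ^ 2 / 2))) := by gcongr
    _ = _ := by ring

/-- After rotation the bound is a product of `|u|^(2 Re ν) exp (-u²/2)` and `exp (-v²/2)`; the first
factor is integrable because `2 Re ν > -1`. -/
theorem integrable_hermiteIntegrand (ℓ m : ℕ) {ν : ℂ} (hν : -(1 / 2 : ℝ) < ν.re) (x : ℝ) :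
    Integrable fun p : ℝ × ℝ => hermiteIntegrand ℓ m ν x p.1 p.2 := by
  obtain ⟨r, hr, hrx⟩ : ∃ r : ℝ, 0 < r ∧ r ^ 2 = 1 + x ^ 2 :=
    ⟨√(1 + x ^ 2), by positivity, Real.sq_sqrt (by positivity)⟩
  obtain ⟨e, he, he'⟩ := exists_rotation_measurableEquiv _ _ (inv_sq_add_mul_inv_sq_eq_one hr hrx)
  rw [← he.integrable_comp_emb e.measurableEmbedding]
  obtain ⟨C, hC⟩ := norm_hermiteIntegrand_le ℓ m ν x
  have h1 := integrable_abs_rpow_mul_exp_neg_mul_sq (by norm_num : (0 : ℝ) < 1 / 2)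
    (by linarith : -1 < 2 * ν.re)
  have h2 := integrable_exp_neg_mul_sq (by norm_num : (0 : ℝ) < 1 / 2)
  refine ((h1.mul_prod h2).const_mul (C * ‖(r : ℂ) ^ (2 * ν)‖)).mono'
    ((measurable_hermiteIntegrand ℓ m ν x).comp e.measurable).aestronglyMeasurable ?_
  have hne : ∀ᵐ p : ℝ × ℝ, p.1 ≠ 0 :=
    Measure.quasiMeasurePreserving_fst.ae (compl_mem_ae_iff.2 (measure_singleton (0 : ℝ)))
  filter_upwards [hne] with ⟨u, v⟩ hu
  simp only [Function.comp_apply, he']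
  refine (hC _ _).trans_eq ?_
  have e1 : r⁻¹ * u + x * r⁻¹ * v - x * (-(x * r⁻¹ * u) + r⁻¹ * v) = r * u := by
    field_simp
    linear_combination -u * hrx
  have e2 : (r⁻¹ * u + x * r⁻¹ * v) ^ 2 + (-(x * r⁻¹ * u) + r⁻¹ * v) ^ 2 = u ^ 2 + v ^ 2 := by
    field_simp
    linear_combination -(u ^ 2 + v ^ 2) * hrx
  rw [e1, e2, abs_mul, abs_of_pos hr, Complex.ofReal_mul,
    Complex.mul_cpow_ofReal_nonneg hr.le (abs_nonneg u), norm_mul, norm_ofReal_abs_cpow ν u hu,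
    mul_add, Real.exp_add]
  ring

theorem integral_hermiteIntegrand (ℓ m : ℕ) {ν : ℂ} (hν : -(1 / 2 : ℝ) < ν.re) {x r : ℝ}
    (hr : 0 < r) (hrx : r ^ 2 = 1 + x ^ 2) :
    (∫ t : ℝ, ∫ s : ℝ, hermiteIntegrand ℓ m ν x s t) =
      (r : ℂ) ^ (2 * ν) * ((√Real.pi * r⁻¹ ^ ℓ * (-(x * r⁻¹)) ^ m : ℝ) : ℂ) *
        absPowGaussianFunctional ν (physHermite (ℓ + m)) := by
  have hI := integrable_hermiteIntegrand ℓ m hν x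
  have hrot := inv_sq_add_mul_inv_sq_eq_one hr hrx
  obtain ⟨e, he, he'⟩ := exists_rotation_measurableEquiv _ _ hrot
  have hIe := (he.integrable_comp_emb e.measurableEmbedding).2 hI
  -- Fubini is used twice: to pass from the iterated integral to the plane, then after rotating to
  -- integrate in `v` first.
  refine (integral_prod_symm _ hI).symm.trans ?_
  refine (he.integral_comp e.measurableEmbedding _).symm.trans ?_
  refine (integral_prod _ hIe).trans ?_
  rw [absPowGaussianFunctional, ← integral_const_mul]
  congr 1 with u
  change ∫ v, hermiteIntegrand ℓ m ν x (e (u, v)).1 (e (u, v)).2 = _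
  simp only [he', hermiteIntegrand_rotate ℓ m ν hr hrx]
  rw [integral_const_mul, integral_complex_ofReal, ← gaussianFunctional_apply,
    gaussianFunctional_rotatedHermite _ _ _ hrot]
  push_cast
  ring

theorem corollary7p2 (ℓ m : ℕ) (hℓm : Even (ℓ + m)) (ν : ℂ) (hν : -(1 / 2 : ℝ) < ν.re) (x : ℝ) :
    Integrable (fun p : ℝ × ℝ => hermiteIntegrand ℓ m ν x p.1 p.2) ∧
    (∫ t : ℝ, ∫ s : ℝ, hermiteIntegrand ℓ m ν x s t) =
      (ascPochhammer ℂ ((ℓ + m) / 2)).eval (-ν) * (-1 : ℂ) ^ (((ℓ : ℤ) - (m : ℤ)) / 2) *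
        (2 : ℂ) ^ (ℓ + m) * (Real.sqrt Real.pi : ℂ) * Complex.Gamma (ν + 1 / 2) *
        ((x : ℂ) ^ 2 + 1) ^ (ν - ((ℓ : ℂ) + (m : ℂ)) / 2) * (x : ℂ) ^ m := by
  refine ⟨integrable_hermiteIntegrand ℓ m hν x, ?_⟩
  obtain ⟨r, hr, hrx⟩ : ∃ r : ℝ, 0 < r ∧ r ^ 2 = 1 + x ^ 2 :=
    ⟨√(1 + x ^ 2), by positivity, Real.sq_sqrt (by positivity)⟩
  obtain ⟨k, hk⟩ := hℓm.two_dvd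
  have hrne : (r : ℂ) ≠ 0 := by exact_mod_cast hr.ne'
  have hbase : (x : ℂ) ^ 2 + 1 = (r : ℂ) * r := by
    rw [add_comm, ← sq]
    exact_mod_cast hrx.symm
  have hexp : ν - ((ℓ : ℂ) + (m : ℂ)) / 2 = ν - k := by
    have : (ℓ : ℂ) + m = 2 * k := by exact_mod_cast hk
    rw [this]
    ring
  -- Factoring the base as `r * r` with `r > 0` makes the complex power multiplicative, with no
  -- branch issue.
  have hpow : ((x : ℂ) ^ 2 + 1) ^ (ν - ((ℓ : ℂ) + (m : ℂ)) / 2) =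
      (r : ℂ) ^ (2 * ν) * ((r : ℂ)⁻¹ ^ ℓ * (r : ℂ)⁻¹ ^ m) := by
    rw [hexp, hbase, Complex.mul_cpow_ofReal_nonneg hr.le hr.le, ← pow_add, hk,
      Complex.cpow_sub _ _ hrne, Complex.cpow_natCast, two_mul, Complex.cpow_add _ _ hrne,
      inv_pow, pow_mul]
    field_simp
    ring
  -- Since `ℓ + m = 2k`, the integer division is exact with value `k - m`. The sign `(-1)^m` comes
  -- from `(-d)^m` and `(-1)^k` from `(-4)^k`.
  have hsign : (-1 : ℂ) ^ (((ℓ : ℤ) - (m : ℤ)) / 2) = (-1) ^ m * (-1) ^ k := by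
    rw [show ((ℓ : ℤ) - (m : ℤ)) / 2 = (k : ℤ) - m by omega, zpow_sub₀ (by norm_num),
      zpow_natCast, zpow_natCast, div_eq_iff (pow_ne_zero _ (by norm_num)), mul_right_comm,
      ← mul_pow]
    norm_num
  rw [integral_hermiteIntegrand ℓ m hν hr hrx, hpow, hsign, hk,
    absPowGaussianFunctional_physHermite hν, Nat.mul_div_cancel_left k two_pos, pow_mul,
    show (-4 : ℂ) = -1 * 2 ^ 2 by norm_num, mul_pow (-1 : ℂ)]
  push_cast
  rw [neg_pow, mul_pow (x : ℂ)]
  ring
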